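/- Let $a_1,a_2$ be the annihilation operators of two bosonic modes on $\ell^2(\mathbb C)^{\otimes 2}$ with number states $|n\rangle|m\rangle$. For $g>0$ and $\theta\in\mathbb R$ put $\lambda=2g$ and let $$|\psi(g,\theta)\rangle=e^{-iH}|0\rangle|0\rangle,\qquad H=\theta(a_1^\dagger a_1+a_2^\dagger a_2)+2g\sin\tfrac{\phi}{2}\left(ie^{-i\phi/2}a_1^\dagger a_2^\dagger+h.c.\right)\ \text{ at }\ \phi=\pi,$$ be the probe state of the Hamiltonian model of the $SU(1,1)$ interferometer. For $\theta^2<\lambda^2$ let $$|\tilde\psi(g,\theta)\rangle=\exp\left(\sqrt{\lambda^2-\theta^2}\left(e^{i(\pi+\arccos(\theta/\lambda))}a_1^\dagger a_2^\dagger-h.c.\right)\right)|0\rangle|0\rangle$$ be its large-$\lambda$ approximation, where $\arccos$ is the principal branch with values in $[0,\pi]$. Let $O$ be the self-adjoint closure of $$\sum_{n=0}^\infty n\left(|n+1\rangle|n+1\rangle\langle n|\langle n|+h.c.\right)$$ on finite linear combinations of number states. For a family of states $\chi(\theta)$ let $$\mathrm{SN}_O(\theta)=\frac{\left(\partial_\theta\langle\chi(\theta)|O|\chi(\theta)\rangle\right)^2}{\langle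 \chi(\theta)|O^2|\chi(\theta)\rangle-\langle \chi(\theta)|O|\chi(\theta)\rangle^2},\qquad \mathrm{QFI}(\theta)=-2\,\partial_{\theta'}^2\left|\langle\chi(\theta)|\chi(\theta')\rangle\right|^2\Big|_{\theta'=\theta}.$$ (1) For every $g>0$, the signal-to-noise ratio of $O$ in the approximate family $\tilde\psi(g,\cdot)$ satisfies $\lim_{\theta\to0}\mathrm{SN}_O(\theta)=\dfrac{\sinh^4(2g)}{g^2}$, and this equals the quantum Fisher information $\mathrm{QFI}(\theta)|_{\theta=0}$ of the Hamiltonian model $\psi(g,\cdot)$. (2) $O$ is an asymptotically optimal readout for the dynamical phase of the Hamiltonian model: for every $g>0$ the limit $S(g)=\lim_{\theta\to0}\mathrm{SN}_O(\theta)$ for the family $\psi(g,\cdot)$ itself exists, and $S(g)/\mathrm{QFI}(\theta)|_{\theta=0}\to1$ as $g\to\infty$. -/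

import Mathlib

noncomputable section

namespace SU11

/-- The two-mode Fock space `ℓ²(ℂ) ⊗ ℓ²(ℂ)`, realised as `ℓ²(ℕ × ℕ)`; the coordinate at `(n, m)` is
the amplitude of the number state `|n⟩|m⟩`. -/
abbrev FockSpace : Type := lp (fun _ : ℕ × ℕ => ℂ) 2

/-- Finite linear combinations of the number states: the common domain of all polynomials in the
creation and annihilation operators. -/
abbrev FiniteVec : Type := (ℕ × ℕ) →₀ ℂ

/-- The number state `|n⟩|m⟩` as a finite vector. -/
def ket (n m : ℕ) : FiniteVec := Finsupp.single (n, m) 1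

/-- The linear map on finite vectors with prescribed values on the number states. -/
def ofKets (f : ℕ × ℕ → FiniteVec) : Module.End ℂ FiniteVec := Finsupp.linearCombination ℂ f

/-- `a₁|n⟩|m⟩ = √n |n-1⟩|m⟩`, which is zero for `n = 0`. -/
def a₁ : Module.End ℂ FiniteVec := ofKets fun p => (Real.sqrt p.1 : ℂ) • ket (p.1 - 1) p.2

/-- `a₂|n⟩|m⟩ = √m |n⟩|m-1⟩`, which is zero for `m = 0`. -/
def a₂ : Module.End ℂ FiniteVec := ofKets fun p => (Real.sqrt p.2 : ℂ) • ket p.1 (p.2 - 1)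

/-- `a₁†|n⟩|m⟩ = √(n+1) |n+1⟩|m⟩`. -/
def a₁dag : Module.End ℂ FiniteVec :=
  ofKets fun p => (Real.sqrt (p.1 + 1) : ℂ) • ket (p.1 + 1) p.2

/-- `a₂†|n⟩|m⟩ = √(m+1) |n⟩|m+1⟩`. -/
def a₂dag : Module.End ℂ FiniteVec :=
  ofKets fun p => (Real.sqrt (p.2 + 1) : ℂ) • ket p.1 (p.2 + 1)

/-- The Hamiltonian of the two-mode interferometer,
`H = θ (a₁†a₁ + a₂†a₂) + 2 g sin(φ/2) (i e^{-iφ/2} a₁†a₂† + h.c.)`. -/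
def hamiltonian (g θ φ : ℝ) : Module.End ℂ FiniteVec :=
  (θ : ℂ) • (a₁dag * a₁ + a₂dag * a₂) +
    ((2 * g * Real.sin (φ / 2) : ℝ) : ℂ) •
      ((Complex.I * Complex.exp (-Complex.I * (φ / 2))) • (a₁dag * a₂dag) +
        (starRingEnd ℂ (Complex.I * Complex.exp (-Complex.I * (φ / 2)))) • (a₁ * a₂))

/-- The exponent `ζ a₁†a₂† - h.c.` of the two-mode squeezing operator. -/
def squeezer (ζ : ℂ) : Module.End ℂ FiniteVec :=
  ζ • (a₁dag * a₂dag) - (starRingEnd ℂ ζ) • (a₁ * a₂)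

/-- The raising part `∑ n |n+1⟩|n+1⟩⟨n|⟨n|` of the readout observable. -/
def readoutRaise : Module.End ℂ FiniteVec :=
  ofKets fun p => if p.1 = p.2 then (p.1 : ℂ) • ket (p.1 + 1) (p.1 + 1) else 0

/-- The Hermitian conjugate `∑ n |n⟩|n⟩⟨n+1|⟨n+1|` of the raising part. -/
def readoutLower : Module.End ℂ FiniteVec :=
  ofKets fun
    | (n + 1, m + 1) => if n = m then (n : ℂ) • ket n n else 0
    | _ => 0

/-- The readout observable `O = ∑ n (|n+1⟩|n+1⟩⟨n|⟨n| + h.c.)` on finite vectors. -/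
def readoutO : Module.End ℂ FiniteVec := readoutRaise + readoutLower

/-- The inclusion of the finite vectors into the Fock space. -/
def embed : FiniteVec →ₗ[ℂ] FockSpace :=
  Finsupp.linearCombination ℂ fun p => lp.single 2 p (1 : ℂ)

/-- The vacuum `|0⟩|0⟩`. -/
def vacuum : FockSpace := embed (ket 0 0)

/-- An operator on the finite vectors, as a densely defined operator on the Fock space. -/
def toOperator (A : Module.End ℂ FiniteVec) : FockSpace →ₗ.[ℂ] FockSpace :=
  (LinearMap.range (embed.prod (embed ∘ₗ A))).toLinearPMap

/-- The operator on the Fock space given by `A`: the operator-theoretic closure of `A`, the finite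
vectors being a core. For `A = hamiltonian g θ φ` and `A = readoutO` it is self-adjoint. -/
def closedOperator (A : Module.End ℂ FiniteVec) : FockSpace →ₗ.[ℂ] FockSpace :=
  (toOperator A).closure

/-- `ψ` is the orbit `t ↦ e^{tT} v`: the strong solution on the whole line of `ψ' = T ψ`, `ψ 0 = v`.
For `T` skew-adjoint and `v` in its domain there is exactly one (Stone). -/
def IsExpOrbit (T : FockSpace →ₗ.[ℂ] FockSpace) (v : FockSpace) (ψ : ℝ → FockSpace) : Prop :=
  ψ 0 = v ∧ ∀ t : ℝ, ∃ h : ψ t ∈ T.domain, HasDerivAt ψ (T ⟨ψ t, h⟩) t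

/-- For an operator with `Re ⟨x, T x⟩ = 0`, the orbit is unique. -/
theorem IsExpOrbit.unique {T : FockSpace →ₗ.[ℂ] FockSpace} {v : FockSpace} {ψ χ : ℝ → FockSpace}
    (hT : ∀ x : T.domain, (inner ℂ (x : FockSpace) (T x)).re = 0)
    (hψ : IsExpOrbit T v ψ) (hχ : IsExpOrbit T v χ) : ψ = χ := by
  have key : ∀ t, HasDerivAt (fun s => ‖ψ s - χ s‖ ^ 2) 0 t := by
    intro t
    obtain ⟨h1, d1⟩ := hψ.2 t
    obtain ⟨h2, d2⟩ := hχ.2 t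
    have h3 := hT (⟨ψ t, h1⟩ - ⟨χ t, h2⟩)
    have d : HasDerivAt (fun s => ‖ψ s - χ s‖ ^ 2) _ t := (d1.sub d2).norm_sq
    rw [← LinearPMap.map_sub] at d
    refine d.congr_deriv (mul_eq_zero_of_right 2 ?_)
    rw [← h3, real_inner_eq_norm_add_mul_self_sub_norm_mul_self_sub_norm_mul_self_div_two]
    exact (re_inner_eq_norm_add_mul_self_sub_norm_mul_self_sub_norm_mul_self_div_two
      (𝕜 := ℂ) _ _).symm
  funext t
  have hc := is_const_of_deriv_eq_zero (fun s => (key s).differentiableAt)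
    (fun s => (key s).deriv) t 0
  simp only [hψ.1, hχ.1, sub_self, norm_zero] at hc
  have : ‖ψ t - χ t‖ = 0 := by simpa using hc
  exact sub_eq_zero.mp (norm_eq_zero.mp this)

open Classical in
/-- The vector `e^{T} v` (zero if there is no orbit of `v`). -/
def expApply (T : FockSpace →ₗ.[ℂ] FockSpace) (v : FockSpace) : FockSpace :=
  if h : ∃ ψ, IsExpOrbit T v ψ then h.choose 1 else 0

/-- The probe state `|ψ(g,θ)⟩ = e^{-iH}|0⟩|0⟩` of the Hamiltonian model at relative phase `φ = π`. -/
def hamiltonianState (g θ : ℝ) : FockSpace :=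
  expApply (closedOperator (-Complex.I • hamiltonian g θ Real.pi)) vacuum

/-- The large-`λ` approximation
`exp(√(λ² - θ²) (e^{i(π + arccos(θ/λ))} a₁†a₂† - h.c.)) |0⟩|0⟩`, `λ = 2 g`, of the probe state. -/
def approxState (g θ : ℝ) : FockSpace :=
  expApply (closedOperator (squeezer
    ((Real.sqrt ((2 * g) ^ 2 - θ ^ 2) : ℂ) *
      Complex.exp (Complex.I * ((Real.pi + Real.arccos (θ / (2 * g)) : ℝ) : ℂ))))) vacuum

open Classical in
/-- `T ψ` for `ψ` in the domain of `T` (zero otherwise). -/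
def applyOp (T : FockSpace →ₗ.[ℂ] FockSpace) (ψ : FockSpace) : FockSpace :=
  if h : ψ ∈ T.domain then T ⟨ψ, h⟩ else 0

/-- The expectation `⟨ψ|T|ψ⟩` of a self-adjoint operator. -/
def expectation (T : FockSpace →ₗ.[ℂ] FockSpace) (ψ : FockSpace) : ℝ :=
  (inner ℂ ψ (applyOp T ψ)).re

/-- The variance `⟨ψ|T²|ψ⟩ - ⟨ψ|T|ψ⟩²` of a self-adjoint operator, with `⟨ψ|T²|ψ⟩ = ‖T ψ‖²`. -/
def variance (T : FockSpace →ₗ.[ℂ] FockSpace) (ψ : FockSpace) : ℝ :=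
  ‖applyOp T ψ‖ ^ 2 - expectation T ψ ^ 2

/-- The signal-to-noise ratio `(∂_θ ⟨ψ(θ)|T|ψ(θ)⟩)² / Var_{ψ(θ)} T`. -/
def signalToNoise (T : FockSpace →ₗ.[ℂ] FockSpace) (ψ : ℝ → FockSpace) (θ : ℝ) : ℝ :=
  deriv (fun t => expectation T (ψ t)) θ ^ 2 / variance T (ψ θ)

/-- The quantum Fisher information `-2 ∂²_{θ'} |⟨ψ(θ)|ψ(θ')⟩|²` at `θ' = θ` of a family of pure
states. -/
def QFI (ψ : ℝ → FockSpace) (θ : ℝ) : ℝ :=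
  -2 * iteratedDeriv 2 (fun t => ‖(inner ℂ (ψ θ) (ψ t) : ℂ)‖ ^ 2) θ

end SU11

end

noncomputable section

namespace SU11

open scoped ComplexConjugate Topology
open Filter

/-! Both generators are of the form -iθ(N₁ + N₂) + β a₁†a₂† - β̄ a₁a₂, which acts on the family
`pairState z` = ∑ zⁿ|n⟩|n⟩ as a first-order differential operator in z. The orbit of the vacuum is
therefore c(t) `pairState (z t)`, where z solves a Riccati equation; linearising it gives
`expApply_quadGen` with hyperbolic functions of κ = √(|β|² - θ²). Skew-symmetry makes orbits unique,
so exhibiting one determines `expApply`; only closability of the operators is used.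

In a normalised state with amplitude z, the mean of O is 2 Re(z)|z|²/(1 - |z|²), and its second
moment is also rational in z, z̄. At θ = 0 both families have z = -i tanh 2g, so the mean vanishes
and the variance is tanh² 2g. Each mean factors as θ h(θ) with h smooth, so the signal-to-noise
limit is h(0)²/tanh² 2g (`tendsto_signalToNoise`). The two values of h(0) differ by a factor tanh
2g, which yields sinh⁴(2g)/g² for the approximation and tanh²(2g) sinh⁴(2g)/g² for the Hamiltonian
model.

The fidelity of the Hamiltonian model is 1/F(θ²) with F(0) = 1 and F'(0) = sinh⁴(2g)/(2g)², so the
Fisher information is 4F'(0) (`QFI_hamiltonianState`). The ratio in the second claim is tanh² 2g,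
which tends to 1. -/

theorem embed_ket (n m : ℕ) : embed (ket n m) = lp.single 2 (n, m) (1 : ℂ) := by
  simp [embed, ket]

theorem ofKets_ket (f : ℕ × ℕ → FiniteVec) (n m : ℕ) : ofKets f (ket n m) = f (n, m) := by
  simp [ofKets, ket]

theorem inner_embed_ket (n m : ℕ) (x : FockSpace) :
    inner ℂ (embed (ket n m)) x = x (n, m) := by
  rw [embed_ket, lp.inner_single_left]
  simp

theorem embed_apply (v : FiniteVec) (p : ℕ × ℕ) : embed v p = v p := by
  induction v using Finsupp.induction_linear with
  | zero => simp
  | add f g hf hg => simp [hf, hg]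
  | single q c =>
    simp only [embed, Finsupp.linearCombination_single]
    rw [lp.coeFn_smul, Pi.smul_apply, lp.single_apply, Finsupp.single_apply, Pi.single_apply]
    by_cases h : q = p
    · simp [h]
    · simp [h, Ne.symm h]

theorem embed_injective : Function.Injective embed := by
  intro u v h
  ext p
  rw [← embed_apply, h, embed_apply]

theorem inner_embed_ket_embed (n m : ℕ) (v : FiniteVec) :
    inner ℂ (embed (ket n m)) (embed v) = v (n, m) := by
  rw [inner_embed_ket, embed_apply]

theorem inner_embed_embed_ket (n m : ℕ) (v : FiniteVec) :
    inner ℂ (embed v) (embed (ket n m)) = conj (v (n, m)) := by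
  rw [← inner_conj_symm, inner_embed_ket_embed]

theorem norm_embed_ket (n m : ℕ) : ‖embed (ket n m)‖ = 1 := by
  rw [embed_ket, lp.norm_single (by norm_num)]
  simp

/-! ### Formal adjoints on finite vectors -/

/-- `B` is a formal adjoint of `A` on the finite vectors. -/
def IsFormalAdjoint (A B : Module.End ℂ FiniteVec) : Prop :=
  ∀ u v, inner ℂ (embed u) (embed (A v)) = inner ℂ (embed (B u)) (embed v)

theorem isFormalAdjoint_of_ket {A B : Module.End ℂ FiniteVec}
    (h : ∀ n m k l, A (ket k l) (n, m) = conj (B (ket n m) (k, l))) : IsFormalAdjoint A B := by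
  intro u v
  induction u using Finsupp.induction_linear with
  | zero => simp
  | add f g hf hg => simp only [map_add, inner_add_left, hf, hg]
  | single p c =>
    induction v using Finsupp.induction_linear with
    | zero => simp
    | add f g hf hg => simp only [map_add, inner_add_right, hf, hg]
    | single q d =>
      have hp : Finsupp.single p c = c • ket p.1 p.2 := by simp [ket]
      have hq : Finsupp.single q d = d • ket q.1 q.2 := by simp [ket]
      rw [hp, hq]
      simp only [map_smul, inner_smul_left, inner_smul_right, inner_embed_ket_embed,
        inner_embed_embed_ket, h]

namespace IsFormalAdjoint

variable {A B C D : Module.End ℂ FiniteVec}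

theorem symm (h : IsFormalAdjoint A B) : IsFormalAdjoint B A := by
  intro u v
  rw [← inner_conj_symm, ← h, inner_conj_symm]

theorem add (h : IsFormalAdjoint A B) (h' : IsFormalAdjoint C D) :
    IsFormalAdjoint (A + C) (B + D) := by
  intro u v
  simp only [LinearMap.add_apply, map_add, inner_add_left, inner_add_right, h u v, h' u v]

theorem smul (c : ℂ) (h : IsFormalAdjoint A B) : IsFormalAdjoint (c • A) (conj c • B) := by
  intro u v
  simp only [LinearMap.smul_apply, map_smul, inner_smul_left, inner_smul_right, h u v,
    Complex.conj_conj]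

theorem mul (h : IsFormalAdjoint A B) (h' : IsFormalAdjoint C D) :
    IsFormalAdjoint (A * C) (D * B) := by
  intro u v
  rw [Module.End.mul_apply, Module.End.mul_apply, h, h']

end IsFormalAdjoint

theorem ket_apply (n m k l : ℕ) : ket n m (k, l) = if n = k ∧ m = l then 1 else 0 := by
  simp [ket, Finsupp.single_apply, Prod.ext_iff]

theorem isFormalAdjoint_a₁ : IsFormalAdjoint a₁ a₁dag := by
  apply isFormalAdjoint_of_ket
  intro n m k l
  simp only [a₁, a₁dag, ofKets_ket, Finsupp.smul_apply, ket_apply, smul_eq_mul]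
  -- At `k = 0` the truncated `k - 1` is harmless because its coefficient is √0.
  rcases k with _ | k
  · simp
  · by_cases h : n = k <;> by_cases h' : m = l <;> simp [h, h', eq_comm]

theorem isFormalAdjoint_a₂ : IsFormalAdjoint a₂ a₂dag := by
  apply isFormalAdjoint_of_ket
  intro n m k l
  simp only [a₂, a₂dag, ofKets_ket, Finsupp.smul_apply, ket_apply, smul_eq_mul]
  rcases l with _ | l
  · simp
  · by_cases h : n = k <;> by_cases h' : m = l <;> simp [h, h', eq_comm]

theorem isFormalAdjoint_readoutRaise : IsFormalAdjoint readoutRaise readoutLower := by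
  apply isFormalAdjoint_of_ket
  intro n m k l
  simp only [readoutRaise, readoutLower, ofKets_ket]
  rcases n with _ | n
  · by_cases h : k = l <;> simp [h, ket_apply]
  rcases m with _ | m
  · by_cases h : k = l <;> simp [h, ket_apply]
  by_cases h : k = l
  · subst h
    by_cases h' : n = m
    · subst h'
      by_cases h'' : k = n <;> simp [h'', ket_apply, eq_comm]
    · have : ¬ (k = n ∧ k = m) := fun e => h' (e.1.symm.trans e.2)
      simp [h', ket_apply, this]
  · by_cases h' : n = m
    · subst h'
      have : ¬ (n = k ∧ n = l) := fun e => h (e.1.symm.trans e.2)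
      simp [h, ket_apply, this]
    · simp [h, h']

theorem isFormalAdjoint_readoutO : IsFormalAdjoint readoutO readoutO := by
  have h := isFormalAdjoint_readoutRaise.add isFormalAdjoint_readoutRaise.symm
  rwa [add_comm readoutLower readoutRaise] at h

theorem end_ext {A B : Module.End ℂ FiniteVec} (h : ∀ n m, A (ket n m) = B (ket n m)) : A = B := by
  apply Finsupp.lhom_ext
  rintro ⟨n, m⟩ c
  have hp : Finsupp.single (n, m) c = c • ket n m := by simp [ket]
  rw [hp, map_smul, map_smul, h]

theorem a₁_mul_a₂_comm : a₁ * a₂ = a₂ * a₁ := by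
  apply end_ext
  intro n m
  simp only [Module.End.mul_apply, a₁, a₂, ofKets_ket, map_smul, smul_smul, mul_comm]

theorem isFormalAdjoint_pairCreate : IsFormalAdjoint (a₁dag * a₂dag) (a₁ * a₂) := by
  rw [a₁_mul_a₂_comm]
  exact isFormalAdjoint_a₁.symm.mul isFormalAdjoint_a₂.symm

theorem isFormalAdjoint_number :
    IsFormalAdjoint (a₁dag * a₁ + a₂dag * a₂) (a₁dag * a₁ + a₂dag * a₂) :=
  (isFormalAdjoint_a₁.symm.mul isFormalAdjoint_a₁).add
    (isFormalAdjoint_a₂.symm.mul isFormalAdjoint_a₂)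

/-! ### The generator common to both families -/

/-- The quadratic generator `-iθ (a₁†a₁ + a₂†a₂) + β a₁†a₂† - β̄ a₁a₂`. -/
def quadGen (θ : ℝ) (β : ℂ) : Module.End ℂ FiniteVec :=
  (-Complex.I * θ) • (a₁dag * a₁ + a₂dag * a₂) + (β • (a₁dag * a₂dag) - conj β • (a₁ * a₂))

theorem squeezer_eq_quadGen (ζ : ℂ) : squeezer ζ = quadGen 0 ζ := by
  simp [squeezer, quadGen]

theorem hamiltonian_eq_quadGen (g θ : ℝ) :
    -Complex.I • hamiltonian g θ Real.pi = quadGen θ (-Complex.I * (2 * g : ℝ)) := by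
  have h : Complex.I * Complex.exp (-Complex.I * ((Real.pi : ℂ) / 2)) = 1 := by
    have : -Complex.I * ((Real.pi : ℂ) / 2) = -Real.pi / 2 * Complex.I := by ring
    rw [this, Complex.exp_neg_pi_div_two_mul_I]
    simp
  rw [hamiltonian, h, quadGen]
  simp only [map_one, Real.sin_pi_div_two, mul_one, one_smul, smul_add, smul_smul, map_mul,
    map_neg, Complex.conj_I, Complex.conj_ofReal]
  module

theorem isFormalAdjoint_quadGen (θ : ℝ) (β : ℂ) :
    IsFormalAdjoint (quadGen θ β) (-quadGen θ β) := by
  have h := (isFormalAdjoint_number.smul (-Complex.I * θ)).add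
    ((isFormalAdjoint_pairCreate.smul β).add (isFormalAdjoint_pairCreate.symm.smul (-conj β)))
  have e1 : -quadGen θ β = conj (-Complex.I * θ) • (a₁dag * a₁ + a₂dag * a₂) +
      (conj β • (a₁ * a₂) + conj (-conj β) • (a₁dag * a₂dag)) := by
    simp only [quadGen, map_mul, map_neg, Complex.conj_I, Complex.conj_ofReal, Complex.conj_conj]
    module
  have e2 : quadGen θ β = (-Complex.I * θ) • (a₁dag * a₁ + a₂dag * a₂) +
      (β • (a₁dag * a₂dag) + (-conj β) • (a₁ * a₂)) := by
    simp only [quadGen]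
    module
  rw [e1, e2]
  exact h

/-! ### Graphs of closures and uniqueness of exponentials -/

theorem toOperator_graph (A : Module.End ℂ FiniteVec) :
    (toOperator A).graph = LinearMap.range (embed.prod (embed ∘ₗ A)) := by
  apply Submodule.toLinearPMap_graph_eq
  rintro _ ⟨v, rfl⟩ hv
  have h : v = 0 := embed_injective (by simpa using hv)
  simp [h]

/-- The adjoint relation is a closed condition on pairs, so it passes from the graph to its closure.
-/
theorem inner_eq_of_mem_closure_graph {A B : Module.End ℂ FiniteVec} (h : IsFormalAdjoint A B)
    {x : FockSpace × FockSpace} (hx : x ∈ (toOperator A).graph.topologicalClosure)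
    (u : FiniteVec) : inner ℂ (embed u) x.2 = inner ℂ (embed (B u)) x.1 := by
  rw [toOperator_graph] at hx
  refine closure_minimal (t := {x : FockSpace × FockSpace |
    inner ℂ (embed u) x.2 = inner ℂ (embed (B u)) x.1}) ?_ ?_ hx
  · rintro _ ⟨v, rfl⟩
    exact h u v
  · exact isClosed_eq (by fun_prop) (by fun_prop)

/-- If (0, y) is in the closed graph, the adjoint relation makes y orthogonal to every number state,
hence zero. -/
theorem isClosable_toOperator {A B : Module.End ℂ FiniteVec} (h : IsFormalAdjoint A B) :
    (toOperator A).IsClosable := by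
  refine ⟨(toOperator A).graph.topologicalClosure.toLinearPMap,
    (Submodule.toLinearPMap_graph_eq _ ?_).symm⟩
  intro x hx hx0
  ext p
  rw [← inner_embed_ket p.1 p.2, inner_eq_of_mem_closure_graph h hx, hx0]
  simp

theorem closedOperator_graph {A B : Module.End ℂ FiniteVec} (h : IsFormalAdjoint A B) :
    (closedOperator A).graph = (toOperator A).graph.topologicalClosure :=
  (isClosable_toOperator h).graph_closure_eq_closure_graph.symm

/-- The way infinite superpositions enter the domain: partial sums lie in the graph, and the closure
contains their limit. -/
theorem mem_closedOperator_graph_of_hasSum {A B : Module.End ℂ FiniteVec}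
    (h : IsFormalAdjoint A B) {v : ℕ → FiniteVec} {x y : FockSpace}
    (hx : HasSum (fun n => embed (v n)) x) (hy : HasSum (fun n => embed (A (v n))) y) :
    (x, y) ∈ (closedOperator A).graph := by
  rw [closedOperator_graph h]
  refine mem_closure_of_tendsto (hx.prodMk hy) (Filter.Eventually.of_forall fun s => ?_)
  apply Submodule.sum_mem
  intro n _
  rw [toOperator_graph]
  exact ⟨v n, rfl⟩

theorem re_inner_closedOperator_eq_zero {A : Module.End ℂ FiniteVec}
    (h : IsFormalAdjoint A (-A)) (x : (closedOperator A).domain) :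
    (inner ℂ (x : FockSpace) (closedOperator A x)).re = 0 := by
  have hx : ((x : FockSpace), closedOperator A x) ∈ (toOperator A).graph.topologicalClosure := by
    rw [← closedOperator_graph h]
    exact LinearPMap.mem_graph _ _
  rw [toOperator_graph] at hx
  refine closure_minimal (t := {x : FockSpace × FockSpace | (inner ℂ x.1 x.2).re = 0}) ?_ ?_ hx
  · rintro _ ⟨v, rfl⟩
    have h1 := congrArg Complex.re (h v v)
    have h2 := congrArg Complex.re (inner_conj_symm (𝕜 := ℂ) (embed v) (embed (A v)))
    simp only [LinearMap.neg_apply, map_neg, inner_neg_left, Complex.conj_re,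
      Complex.neg_re] at h1 h2
    change (inner ℂ (embed v) (embed (A v))).re = 0
    linarith
  · exact isClosed_eq (by fun_prop) (by fun_prop)

theorem expApply_eq {A : Module.End ℂ FiniteVec} (h : IsFormalAdjoint A (-A)) {v : FockSpace}
    {ψ : ℝ → FockSpace} (hψ : IsExpOrbit (closedOperator A) v ψ) :
    expApply (closedOperator A) v = ψ 1 := by
  have hex : ∃ ψ, IsExpOrbit (closedOperator A) v ψ := ⟨ψ, hψ⟩
  rw [expApply, dif_pos hex,
    IsExpOrbit.unique (re_inner_closedOperator_eq_zero h) hex.choose_spec hψ]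

theorem exists_apply_eq_of_mem_graph {T : FockSpace →ₗ.[ℂ] FockSpace} {x y : FockSpace}
    (h : (x, y) ∈ T.graph) : ∃ hx : x ∈ T.domain, T ⟨x, hx⟩ = y :=
  ⟨LinearPMap.mem_domain_of_mem_graph h, ((LinearPMap.image_iff _).2 h).symm⟩

theorem applyOp_eq {T : FockSpace →ₗ.[ℂ] FockSpace} {x y : FockSpace}
    (h : (x, y) ∈ T.graph) : applyOp T x = y := by
  obtain ⟨hx, e⟩ := exists_apply_eq_of_mem_graph h
  rw [applyOp, dif_pos hx, e]

/-! ### Photon-pair states and the action of the generator on them -/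

theorem ofReal_sqrt_mul_self {x : ℝ} (hx : 0 ≤ x) : (Real.sqrt x : ℂ) * Real.sqrt x = x := by
  rw [← Complex.ofReal_mul, Real.mul_self_sqrt hx]

theorem quadGen_ket (θ : ℝ) (β : ℂ) (n : ℕ) :
    quadGen θ β (ket n n) = (-2 * Complex.I * θ * n) • ket n n +
      (β * (n + 1)) • ket (n + 1) (n + 1) - (conj β * n) • ket (n - 1) (n - 1) := by
  have h1 := ofReal_sqrt_mul_self (x := n + 1) (by positivity)
  have h0 := ofReal_sqrt_mul_self (x := n) (by positivity)
  push_cast at h1 h0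
  simp only [quadGen, a₁, a₂, a₁dag, a₂dag, LinearMap.add_apply, LinearMap.sub_apply,
    LinearMap.smul_apply, Module.End.mul_apply, ofKets_ket, map_smul, smul_smul, h1, h0]
  rcases n with _ | n
  · simp
  · simp only [Nat.add_sub_cancel, ← Nat.cast_succ, h0]
    module

theorem readoutO_ket (n : ℕ) :
    readoutO (ket n n) = (n : ℂ) • ket (n + 1) (n + 1) +
      ((n - 1 : ℕ) : ℂ) • ket (n - 1) (n - 1) := by
  rcases n with _ | n <;> simp [readoutO, readoutRaise, readoutLower, ofKets_ket]

/-- The photon-pair number state `|n⟩|n⟩` in the Fock space. -/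
def pairKet (n : ℕ) : FockSpace := embed (ket n n)

theorem norm_pairKet (n : ℕ) : ‖pairKet n‖ = 1 := norm_embed_ket n n

theorem inner_pairKet_pairKet (m n : ℕ) :
    inner ℂ (pairKet m) (pairKet n) = if n = m then (1 : ℂ) else 0 := by
  rw [pairKet, pairKet, inner_embed_ket_embed, ket_apply]
  simp

/-- The unnormalised two-mode squeezed vacuum `∑ zⁿ |n⟩|n⟩`. -/
def pairState (z : ℂ) : FockSpace := ∑' n : ℕ, z ^ n • pairKet n

/-- The derivative `∑ n zⁿ⁻¹ |n⟩|n⟩` of `pairState`. -/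
def pairState' (z : ℂ) : FockSpace := ∑' n : ℕ, (n * z ^ (n - 1)) • pairKet n

theorem summable_smul_pairKet {a : ℕ → ℂ} (ha : Summable fun n => ‖a n‖) (f : ℕ → ℕ) :
    Summable fun n => a n • pairKet (f n) := by
  refine Summable.of_norm ?_
  simpa [norm_smul, norm_pairKet] using ha

theorem summable_norm_nat_mul_pow_pred {z : ℂ} (hz : ‖z‖ < 1) :
    Summable fun n : ℕ => ‖(n : ℂ) * z ^ (n - 1)‖ := by
  rw [← summable_nat_add_iff 1]
  have h1 := summable_norm_pow_mul_geometric_of_norm_lt_one 1 hz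
  have h2 := summable_norm_geometric_of_norm_lt_one hz
  refine Summable.of_nonneg_of_le (fun _ => norm_nonneg _) (fun n => ?_) (h1.add h2)
  refine le_trans (le_of_eq ?_) (norm_add_le _ _)
  congr 1
  push_cast
  simp
  ring

theorem hasSum_pairState {z : ℂ} (hz : ‖z‖ < 1) :
    HasSum (fun n => z ^ n • pairKet n) (pairState z) :=
  (summable_smul_pairKet (summable_norm_geometric_of_norm_lt_one hz) fun n => n).hasSum

theorem hasSum_pairState' {z : ℂ} (hz : ‖z‖ < 1) :
    HasSum (fun n : ℕ => (n * z ^ (n - 1)) • pairKet n) (pairState' z) :=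
  (summable_smul_pairKet (summable_norm_nat_mul_pow_pred hz) fun n => n).hasSum

theorem hasDerivAt_pairState {z : ℂ} (hz : ‖z‖ < 1) :
    HasDerivAt pairState (pairState' z) z := by
  obtain ⟨r, hzr, hr⟩ := exists_between hz
  have hr0 : 0 ≤ r := (norm_nonneg z).trans hzr.le
  have hrn : ‖(r : ℂ)‖ < 1 := by simpa [abs_of_nonneg hr0] using hr
  -- On the ball of radius r, with ‖z‖ < r < 1, the differentiated series is dominated by the
  -- convergent ∑ n rⁿ⁻¹.
  refine hasDerivAt_tsum_of_isPreconnected (summable_norm_nat_mul_pow_pred hrn)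
    (Metric.isOpen_ball (x := (0 : ℂ)) (ε := r)) (convex_ball _ _).isPreconnected
    (g := fun n y => y ^ n • pairKet n) (fun n y _ => (hasDerivAt_pow n y).smul_const _)
    (fun n y hy => ?_) (y₀ := z) (by simpa using hzr) (hasSum_pairState hz).summable
    (by simpa using hzr)
  rw [norm_smul, norm_pairKet, mul_one, norm_mul, norm_mul, norm_pow, norm_pow]
  have hy' : ‖y‖ ≤ r := by simpa using (mem_ball_zero_iff.1 hy).le
  have : ‖(r : ℂ)‖ = r := by simp [abs_of_nonneg hr0]
  rw [this]
  gcongr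

theorem hasSum_nat_succ {f : ℕ → FockSpace} {x : FockSpace} (h0 : f 0 = 0) :
    HasSum (fun n => f (n + 1)) x ↔ HasSum f x := by
  simpa [h0] using hasSum_nat_add_iff (f := f) (g := x) 1

theorem embed_smul_ket (a : ℂ) (n : ℕ) : embed (a • ket n n) = a • pairKet n := by
  rw [map_smul, pairKet]

/-- On this family N₁ + N₂ acts as 2z d/dz, a₁†a₂† as d/dz, and a₁a₂ as z² d/dz + z. -/
theorem mem_graph_quadGen (θ : ℝ) (β : ℂ) {z : ℂ} (hz : ‖z‖ < 1) :
    (pairState z, (-2 * Complex.I * θ * z + β - conj β * z ^ 2) • pairState' z -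
      (conj β * z) • pairState z) ∈ (closedOperator (quadGen θ β)).graph := by
  apply mem_closedOperator_graph_of_hasSum (isFormalAdjoint_quadGen θ β)
    (v := fun n => z ^ n • ket n n)
  · simpa only [embed_smul_ket] using hasSum_pairState hz
  · have hD := hasSum_pairState hz
    have hD' := hasSum_pairState' hz
    have h1 : HasSum (fun n : ℕ => (n * z ^ n) • pairKet n) (z • pairState' z) := by
      refine (hD'.const_smul z).congr_fun fun n => ?_
      rw [smul_smul]
      rcases n with _ | n
      · simp
      · congr 1
        simp
        ring
    have h2 : HasSum (fun n : ℕ => ((n + 1) * z ^ n) • pairKet (n + 1)) (pairState' z) := by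
      rw [← hasSum_nat_succ (by simp)] at hD'
      simpa using hD'
    have h3 : HasSum (fun n : ℕ => (n * z ^ n) • pairKet (n - 1))
        (z • (z • pairState' z + pairState z)) := by
      rw [← hasSum_nat_succ (by simp)]
      refine ((h1.add hD).const_smul z).congr_fun fun n => ?_
      rw [← add_smul, smul_smul, Nat.add_sub_cancel]
      congr 1
      push_cast
      ring
    have h := ((h1.const_smul (-2 * Complex.I * θ)).add (h2.const_smul β)).sub
      (h3.const_smul (conj β))
    convert h using 1
    · funext n
      rw [map_smul, quadGen_ket, map_smul]
      simp only [map_add, map_sub, embed_smul_ket]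
      module
    · module

/-- The generator is tangent to the family, so matching the coefficients of `pairState'` and
`pairState` leaves two scalar equations: a Riccati equation for z and a linear one for c. -/
theorem isExpOrbit_quadGen {θ : ℝ} {β : ℂ} {c z : ℝ → ℂ} (hz : ∀ t, ‖z t‖ < 1) (hc0 : c 0 = 1)
    (hz0 : z 0 = 0) (hc : ∀ t, HasDerivAt c (-(conj β * c t * z t)) t)
    (hz' : ∀ t, HasDerivAt z (-2 * Complex.I * θ * z t + β - conj β * z t ^ 2) t) :
    IsExpOrbit (closedOperator (quadGen θ β)) vacuum fun t => c t • pairState (z t) := by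
  constructor
  · simp only [hc0, hz0, one_smul]
    refine (hasSum_pairState (by simp)).unique ?_
    have := hasSum_single (f := fun n : ℕ => (0 : ℂ) ^ n • pairKet n) 0 (fun n hn => by simp [hn])
    simpa [vacuum, pairKet] using this
  · intro t
    have hm := Submodule.smul_mem _ (c t) (mem_graph_quadGen θ β (hz t))
    obtain ⟨hx, e⟩ := exists_apply_eq_of_mem_graph hm
    refine ⟨hx, ?_⟩
    rw [e]
    have hd : HasDerivAt (fun t => pairState (z t)) _ t :=
      (hasDerivAt_pairState (hz t)).scomp t (hz' t)
    refine ((hc t).smul hd).congr_deriv ?_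
    module

/-! ### Solution of the Riccati equation -/

/-- The denominator `cosh κt + iθ sinh κt / κ` of the squeezing amplitude. -/
def amplitudeDen (θ κ t : ℝ) : ℂ := Real.cosh (κ * t) + Complex.I * θ * Real.sinh (κ * t) / κ

/-- The numerator `β sinh κt / κ` of the squeezing amplitude. -/
def amplitudeNum (β : ℂ) (κ t : ℝ) : ℂ := β * Real.sinh (κ * t) / κ

section

variable {θ κ : ℝ} {β : ℂ}

theorem norm_amplitudeNum_sq (β : ℂ) (κ t : ℝ) :
    ‖amplitudeNum β κ t‖ ^ 2 = ‖β‖ ^ 2 * (Real.sinh (κ * t) / κ) ^ 2 := by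
  rw [amplitudeNum, norm_div, norm_mul, Complex.norm_real, Complex.norm_real, div_pow, mul_pow,
    Real.norm_eq_abs, Real.norm_eq_abs, sq_abs, sq_abs]
  ring

theorem norm_amplitudeDen_sq (θ κ t : ℝ) :
    ‖amplitudeDen θ κ t‖ ^ 2 = Real.cosh (κ * t) ^ 2 + θ ^ 2 * (Real.sinh (κ * t) / κ) ^ 2 := by
  have : amplitudeDen θ κ t = (Real.cosh (κ * t) : ℝ) +
      (θ * (Real.sinh (κ * t) / κ) : ℝ) * Complex.I := by
    rw [amplitudeDen]
    push_cast
    ring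
  rw [this, ← Complex.normSq_eq_norm_sq, Complex.normSq_add_mul_I]
  ring

/-- The SU(1,1) invariant |D|² - |N|² = 1: it keeps D away from zero and the amplitude N/D inside
the unit disc. -/
theorem norm_amplitudeDen_sq_eq (hκ : 0 < κ) (h : κ ^ 2 + θ ^ 2 = ‖β‖ ^ 2) (t : ℝ) :
    ‖amplitudeDen θ κ t‖ ^ 2 = 1 + ‖amplitudeNum β κ t‖ ^ 2 := by
  rw [norm_amplitudeNum_sq, norm_amplitudeDen_sq, ← h, Real.cosh_sq]
  field_simp
  ring

theorem amplitudeDen_ne_zero (hκ : 0 < κ) (h : κ ^ 2 + θ ^ 2 = ‖β‖ ^ 2) (t : ℝ) :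
    amplitudeDen θ κ t ≠ 0 := by
  intro h0
  have := norm_amplitudeDen_sq_eq hκ h t
  rw [h0] at this
  simp at this
  nlinarith [sq_nonneg ‖amplitudeNum β κ t‖]

theorem norm_amplitude_sq (hκ : 0 < κ) (h : κ ^ 2 + θ ^ 2 = ‖β‖ ^ 2) (t : ℝ) :
    ‖amplitudeNum β κ t / amplitudeDen θ κ t‖ ^ 2 = 1 - 1 / ‖amplitudeDen θ κ t‖ ^ 2 := by
  have h1 := norm_amplitudeDen_sq_eq hκ h t
  have h2 : ‖amplitudeDen θ κ t‖ ≠ 0 := norm_ne_zero_iff.2 (amplitudeDen_ne_zero hκ h t)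
  rw [norm_div]
  field_simp
  linarith

theorem norm_amplitude_lt_one (hκ : 0 < κ) (h : κ ^ 2 + θ ^ 2 = ‖β‖ ^ 2) (t : ℝ) :
    ‖amplitudeNum β κ t / amplitudeDen θ κ t‖ < 1 := by
  have h2 : 0 < ‖amplitudeDen θ κ t‖ := norm_pos_iff.2 (amplitudeDen_ne_zero hκ h t)
  have h1 := norm_amplitude_sq hκ h t
  have h3 : 0 < 1 / ‖amplitudeDen θ κ t‖ ^ 2 := by positivity
  nlinarith [norm_nonneg (amplitudeNum β κ t / amplitudeDen θ κ t)]

theorem hasDerivAt_ofReal_cosh (κ t : ℝ) : HasDerivAt (fun s : ℝ => (Real.cosh (κ * s) : ℂ))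
    (κ * Real.sinh (κ * t)) t := by
  have h : HasDerivAt (fun s : ℝ => Real.cosh (κ * s)) (Real.sinh (κ * t) * (κ * 1)) t :=
    ((hasDerivAt_id t).const_mul κ).cosh
  convert h.ofReal_comp using 1
  push_cast
  ring

theorem hasDerivAt_ofReal_sinh (κ t : ℝ) : HasDerivAt (fun s : ℝ => (Real.sinh (κ * s) : ℂ))
    (κ * Real.cosh (κ * t)) t := by
  have h : HasDerivAt (fun s : ℝ => Real.sinh (κ * s)) (Real.cosh (κ * t) * (κ * 1)) t :=
    ((hasDerivAt_id t).const_mul κ).sinh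
  convert h.ofReal_comp using 1
  push_cast
  ring

/-- With `hasDerivAt_amplitudeDen`, this is the linear system whose projective quotient N/D solves
the Riccati equation; its matrix squares to κ². -/
theorem hasDerivAt_amplitudeNum (hκ : 0 < κ) (t : ℝ) :
    HasDerivAt (amplitudeNum β κ)
      (-Complex.I * θ * amplitudeNum β κ t + β * amplitudeDen θ κ t) t := by
  have hκ' : (κ : ℂ) ≠ 0 := by exact_mod_cast hκ.ne'
  refine (((hasDerivAt_ofReal_sinh κ t).const_mul β).div_const (κ : ℂ)).congr_deriv ?_
  rw [amplitudeNum, amplitudeDen]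
  field_simp
  ring

theorem hasDerivAt_amplitudeDen (hκ : 0 < κ) (h : κ ^ 2 + θ ^ 2 = ‖β‖ ^ 2) (t : ℝ) :
    HasDerivAt (amplitudeDen θ κ)
      (Complex.I * θ * amplitudeDen θ κ t + conj β * amplitudeNum β κ t) t := by
  have hκ' : (κ : ℂ) ≠ 0 := by exact_mod_cast hκ.ne'
  have hβ : conj β * β = (κ : ℂ) ^ 2 + (θ : ℂ) ^ 2 := by
    rw [Complex.conj_mul']
    exact_mod_cast h.symm
  refine ((hasDerivAt_ofReal_cosh κ t).add (((hasDerivAt_ofReal_sinh κ t).const_mul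
    (Complex.I * θ)).div_const (κ : ℂ))).congr_deriv ?_
  have e : conj β * amplitudeNum β κ t =
      ((κ : ℂ) ^ 2 + (θ : ℂ) ^ 2) * Real.sinh (κ * t) / κ := by
    rw [amplitudeNum, ← hβ]
    ring
  rw [e, amplitudeDen]
  field_simp
  linear_combination (-(θ : ℂ) ^ 2 * Real.sinh (κ * t)) * Complex.I_sq

theorem expApply_quadGen (hκ : 0 < κ) (h : κ ^ 2 + θ ^ 2 = ‖β‖ ^ 2) :
    expApply (closedOperator (quadGen θ β)) vacuum =
      (Complex.exp (Complex.I * θ) / amplitudeDen θ κ 1) •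
        pairState (amplitudeNum β κ 1 / amplitudeDen θ κ 1) := by
  have hW := amplitudeDen_ne_zero (β := β) hκ h
  have horb := isExpOrbit_quadGen (θ := θ) (β := β)
    -- From D'/D = iθ + β̄z, the equation c'/c = -β̄z integrates to e^{iθt}/D.
    (c := fun t => Complex.exp (Complex.I * θ * t) / amplitudeDen θ κ t)
    (z := fun t => amplitudeNum β κ t / amplitudeDen θ κ t)
    (norm_amplitude_lt_one hκ h) (by simp [amplitudeDen]) (by simp [amplitudeNum])
    (fun t => by
      have he : HasDerivAt (fun t : ℝ => Complex.exp (Complex.I * θ * t))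
          (Complex.exp (Complex.I * θ * t) * (Complex.I * θ * 1)) t :=
        ((hasDerivAt_id t).ofReal_comp.const_mul (Complex.I * θ)).cexp
      refine (he.div (hasDerivAt_amplitudeDen hκ h t) (hW t)).congr_deriv ?_
      have := hW t
      field_simp
      ring)
    (fun t => by
      refine ((hasDerivAt_amplitudeNum (θ := θ) hκ t).div
        (hasDerivAt_amplitudeDen hκ h t) (hW t)).congr_deriv ?_
      have := hW t
      field_simp
      ring)
  rw [expApply_eq (isFormalAdjoint_quadGen θ β) horb]
  simp

end

/-! ### Overlaps and moments of the readout -/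

theorem inner_pairKet_of_hasSum {a : ℕ → ℂ} {x : FockSpace}
    (hx : HasSum (fun n => a n • pairKet n) x) (m : ℕ) : inner ℂ (pairKet m) x = a m := by
  have h := hx.mapL (innerSL ℂ (pairKet m))
  simp only [innerSL_apply_apply, inner_smul_right, inner_pairKet_pairKet] at h
  refine h.unique ?_
  refine (hasSum_ite_eq m (a m)).congr_fun fun n => ?_
  by_cases hn : n = m <;> simp [hn]

theorem hasSum_inner_of_hasSum {b : ℕ → ℂ} {f : ℕ → ℕ} {y : FockSpace}
    (hy : HasSum (fun n => b n • pairKet (f n)) y) {x : FockSpace} {a : ℕ → ℂ}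
    (ha : ∀ m, inner ℂ (pairKet m) x = a m) :
    HasSum (fun n => conj (a (f n)) * b n) (inner ℂ x y) := by
  refine (hy.mapL (innerSL ℂ x)).congr_fun fun n => ?_
  rw [innerSL_apply_apply, inner_smul_right, ← inner_conj_symm, ha, mul_comm]

theorem inner_pairState {z w : ℂ} (hz : ‖z‖ < 1) (hw : ‖w‖ < 1) :
    inner ℂ (pairState z) (pairState w) = (1 - conj z * w)⁻¹ := by
  refine (hasSum_inner_of_hasSum (hasSum_pairState hw)
    (inner_pairKet_of_hasSum (hasSum_pairState hz))).unique ?_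
  have h : ‖conj z * w‖ < 1 := by
    rw [norm_mul, RCLike.norm_conj]
    nlinarith [norm_nonneg z, norm_nonneg w]
  simpa [mul_pow] using hasSum_geometric_of_norm_lt_one h

/-- The image `∑ zᵐ (m + (m + 1) z²) |m + 1⟩|m + 1⟩` of `pairState z` under the readout. -/
def readoutPairState (z : ℂ) : FockSpace :=
  ∑' m : ℕ, (z ^ m * (m + (m + 1) * z ^ 2)) • pairKet (m + 1)

theorem summable_norm_nat_mul_pow {z : ℂ} (hz : ‖z‖ < 1) :
    Summable fun n : ℕ => ‖(n : ℂ) * z ^ n‖ := by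
  simpa using summable_norm_pow_mul_geometric_of_norm_lt_one 1 hz

theorem hasSum_readoutPairState {z : ℂ} (hz : ‖z‖ < 1) :
    HasSum (fun m : ℕ => (z ^ m * (m + (m + 1) * z ^ 2)) • pairKet (m + 1))
      (readoutPairState z) := by
  have h1 := summable_norm_nat_mul_pow hz
  have h2 := summable_norm_geometric_of_norm_lt_one hz
  have h3 := (summable_smul_pairKet h1 (· + 1)).add
    (((summable_smul_pairKet h1 (· + 1)).add (summable_smul_pairKet h2 (· + 1))).const_smul (z ^ 2))
  refine (h3.congr fun m => ?_).hasSum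
  module

theorem mem_graph_readoutO {z : ℂ} (hz : ‖z‖ < 1) :
    (pairState z, readoutPairState z) ∈ (closedOperator readoutO).graph := by
  apply mem_closedOperator_graph_of_hasSum isFormalAdjoint_readoutO
    (v := fun n => z ^ n • ket n n)
  · simpa only [embed_smul_ket] using hasSum_pairState hz
  · have h1 := (summable_smul_pairKet (summable_norm_nat_mul_pow hz) (· + 1)).hasSum
    have h2 := (hasSum_readoutPairState hz).sub h1
    have h3 : HasSum (fun n : ℕ => (z ^ n * (n - 1 : ℕ)) • pairKet (n - 1))
        (readoutPairState z - ∑' n : ℕ, (n * z ^ n) • pairKet (n + 1)) := by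
      rw [← hasSum_nat_succ (by simp), ← hasSum_nat_succ (by simp)]
      refine h2.congr_fun fun n => ?_
      simp only [Nat.add_sub_cancel]
      push_cast
      module
    convert h1.add h3 using 1
    · funext n
      rw [map_smul, readoutO_ket, map_smul, map_add, embed_smul_ket, embed_smul_ket]
      module
    · abel

theorem hasSum_sq_mul_geometric {x : ℝ} (h0 : ‖x‖ < 1) :
    HasSum (fun n : ℕ => (n : ℝ) ^ 2 * x ^ n) (x * (1 + x) / (1 - x) ^ 3) := by
  have hx : 1 - x ≠ 0 := by
    intro h
    have : x = 1 := by linarith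
    simp [this] at h0
  have h2 := hasSum_choose_mul_geometric_of_norm_lt_one 2 h0
  have h1 := hasSum_coe_mul_geometric_of_norm_lt_one h0
  have hval : x * (1 + x) / (1 - x) ^ 3 =
      2 * (1 / (1 - x) ^ (2 + 1)) - 3 * (x / (1 - x) ^ 2) - 2 * (1 - x)⁻¹ := by
    field_simp
    ring
  rw [hval]
  -- Uses n² = 2·C(n+2, 2) - 3n - 2.
  refine (((h2.mul_left 2).sub (h1.mul_left 3)).sub
    ((hasSum_geometric_of_norm_lt_one h0).mul_left 2)).congr_fun fun n => ?_
  rw [Nat.cast_choose_two]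
  push_cast
  ring

theorem inner_pairState_readout {z : ℂ} (hz : ‖z‖ < 1) :
    (inner ℂ (pairState z) (readoutPairState z)).re =
      2 * z.re * ‖z‖ ^ 2 / (1 - ‖z‖ ^ 2) ^ 2 := by
  have hx : ‖conj z * z‖ < 1 := by
    rw [norm_mul, RCLike.norm_conj]
    nlinarith [norm_nonneg z]
  have h := hasSum_inner_of_hasSum (hasSum_readoutPairState hz)
    (inner_pairKet_of_hasSum (hasSum_pairState hz))
  have h1 := hasSum_coe_mul_geometric_of_norm_lt_one hx
  have h0 := hasSum_geometric_of_norm_lt_one hx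
  have h' := (h1.add ((h1.add h0).mul_left (z ^ 2))).mul_left (conj z)
  have e := h.unique (h'.congr_fun fun n => by
    rw [map_pow, mul_pow]
    ring)
  have hn : conj z * z = ((‖z‖ ^ 2 : ℝ) : ℂ) := by
    rw [Complex.conj_mul']
    push_cast
    rfl
  have hne : 1 - ‖z‖ ^ 2 ≠ 0 := by nlinarith [norm_nonneg z]
  have hne' : (1 : ℂ) - ((‖z‖ ^ 2 : ℝ) : ℂ) ≠ 0 := by exact_mod_cast hne
  have e2 : inner ℂ (pairState z) (readoutPairState z) =
      ((2 * z.re * ‖z‖ ^ 2 / (1 - ‖z‖ ^ 2) ^ 2 : ℝ) : ℂ) := by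
    have hre : ((2 * z.re : ℝ) : ℂ) = z + conj z := (Complex.add_conj z).symm
    rw [e, Complex.ofReal_div, Complex.ofReal_mul, hre,
      Complex.ofReal_pow (1 - ‖z‖ ^ 2),
      Complex.ofReal_sub, Complex.ofReal_one, hn]
    generalize ((‖z‖ ^ 2 : ℝ) : ℂ) = N at hn hne'
    field_simp
    linear_combination z * hn
  rw [e2, Complex.ofReal_re]

/-- The second moment of the readout in the unnormalised state `pairState z`, in closed form. -/
theorem norm_readoutPairState_sq {z : ℂ} (hz : ‖z‖ < 1) :
    ‖readoutPairState z‖ ^ 2 =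
      ‖1 + z ^ 2‖ ^ 2 * (‖z‖ ^ 2 * (1 + ‖z‖ ^ 2) / (1 - ‖z‖ ^ 2) ^ 3) +
        2 * (conj (z ^ 2) * (1 + z ^ 2)).re * (‖z‖ ^ 2 / (1 - ‖z‖ ^ 2) ^ 2) +
          ‖z ^ 2‖ ^ 2 * (1 - ‖z‖ ^ 2)⁻¹ := by
  have hx : ‖‖z‖ ^ 2‖ < 1 := by
    rw [norm_pow, norm_norm]
    nlinarith [norm_nonneg z]
  have hcoef : ∀ m : ℕ, inner ℂ (pairKet (m + 1)) (readoutPairState z) =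
      z ^ m * (m + (m + 1) * z ^ 2) := by
    intro m
    -- The image starts at |1⟩|1⟩, so the coefficient sequence is shifted by one and padded with 0.
    refine inner_pairKet_of_hasSum (a := fun n => if n = 0 then 0 else
      z ^ (n - 1) * ((n - 1 : ℕ) + ((n - 1 : ℕ) + 1) * z ^ 2)) ?_ (m + 1)
    rw [← hasSum_nat_succ (by simp)]
    simpa using hasSum_readoutPairState hz
  have h := Complex.hasSum_re
    ((hasSum_readoutPairState hz).mapL (innerSL ℂ (readoutPairState z)))
  rw [innerSL_apply_apply] at h
  have hn : ‖readoutPairState z‖ ^ 2 =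
      (inner ℂ (readoutPairState z) (readoutPairState z)).re :=
    norm_sq_eq_re_inner (𝕜 := ℂ) _
  rw [hn]
  refine h.unique ?_
  have h' := ((((hasSum_sq_mul_geometric hx).mul_left (‖1 + z ^ 2‖ ^ 2)).add
    ((hasSum_coe_mul_geometric_of_norm_lt_one hx).mul_left
      (2 * (conj (z ^ 2) * (1 + z ^ 2)).re))).add
    ((hasSum_geometric_of_norm_lt_one hx).mul_left (‖z ^ 2‖ ^ 2)))
  refine h'.congr_fun fun m => ?_
  rw [innerSL_apply_apply, inner_smul_right, ← inner_conj_symm, hcoef, mul_comm,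
    Complex.conj_mul', ← Complex.ofReal_pow, Complex.ofReal_re, norm_mul, norm_pow]
  generalize z ^ 2 = w
  -- The coefficient is m(1 + w) + w, so the second moment splits into sums of m²xᵐ, m xᵐ and xᵐ at
  -- x = ‖z‖².
  have hq : ‖(m : ℂ) + (m + 1) * w‖ ^ 2 =
      (m : ℝ) ^ 2 * ‖1 + w‖ ^ 2 + 2 * m * (conj w * (1 + w)).re + ‖w‖ ^ 2 := by
    simp only [← Complex.normSq_eq_norm_sq, Complex.normSq_apply]
    simp
    ring
  rw [mul_pow, hq]
  ring

/-! ### Derivatives at θ = 0 of functions θ h(θ) and G(θ²) -/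

theorem contDiffAt_deriv {f : ℝ → ℝ} {x : ℝ} {m n : WithTop ℕ∞} (hf : ContDiffAt ℝ n f x)
    (hmn : m + 1 ≤ n) : ContDiffAt ℝ m (deriv f) x :=
  (hf.fderiv_right hmn).clm_apply contDiffAt_const

theorem tendsto_deriv_of_eventuallyEq_mul {f h : ℝ → ℝ} (hf : f =ᶠ[𝓝 0] fun θ => θ * h θ)
    (hh : ContDiffAt ℝ 1 h 0) : Tendsto (deriv f) (𝓝 0) (𝓝 (h 0)) := by
  have hc : ContDiffAt ℝ 1 (fun θ => θ * h θ) 0 := contDiffAt_id.mul hh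
  have h1 : ContinuousAt (deriv fun θ => θ * h θ) 0 :=
    (contDiffAt_deriv (m := 0) hc (by simp)).continuousAt
  have h2 : deriv (fun θ => θ * h θ) 0 = h 0 := by
    have : HasDerivAt (fun θ => θ * h θ) _ 0 :=
      (hasDerivAt_id (0 : ℝ)).mul (hh.differentiableAt (by simp)).hasDerivAt
    simpa using this.deriv
  rw [ContinuousAt, h2] at h1
  exact h1.congr' hf.deriv.symm

/-- Since f' = 2θ G'(θ²), the second derivative at 0 needs only the first derivative of G there. -/
theorem iteratedDeriv_two_of_eventuallyEq_sq {f G : ℝ → ℝ} (hf : f =ᶠ[𝓝 0] fun θ => G (θ ^ 2))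
    (hG : ContDiffAt ℝ 2 G 0) : iteratedDeriv 2 f 0 = 2 * deriv G 0 := by
  have hsq : Tendsto (fun θ : ℝ => θ ^ 2) (𝓝 0) (𝓝 0) := by
    have : ContinuousAt (fun θ : ℝ => θ ^ 2) 0 := by fun_prop
    simpa [ContinuousAt] using this
  have h1 : deriv f =ᶠ[𝓝 0] fun θ => θ * (2 * deriv G (θ ^ 2)) := by
    refine hf.deriv.trans ?_
    filter_upwards [hsq.eventually (hG.eventually (by simp))] with θ hθ
    have hd : HasDerivAt (fun θ : ℝ => G (θ ^ 2)) _ θ :=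
      HasDerivAt.comp (h := fun θ : ℝ => θ ^ 2) θ (hθ.differentiableAt (by simp)).hasDerivAt
        (hasDerivAt_pow 2 θ)
    rw [hd.deriv]
    simp
    ring
  have h2 : DifferentiableAt ℝ (fun θ : ℝ => 2 * deriv G (θ ^ 2)) 0 := by
    have hd : DifferentiableAt ℝ (deriv G) ((0 : ℝ) ^ 2) := by
      rw [zero_pow two_ne_zero]
      exact (contDiffAt_deriv (m := 1) hG (by norm_num)).differentiableAt (by simp)
    exact (DifferentiableAt.comp (f := fun θ : ℝ => θ ^ 2) (0 : ℝ) hd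
      (differentiableAt_pow 2)).const_mul 2
  have h3 : HasDerivAt (fun θ => θ * (2 * deriv G (θ ^ 2))) _ 0 :=
    (hasDerivAt_id (0 : ℝ)).mul h2.hasDerivAt
  rw [iteratedDeriv_succ, iteratedDeriv_one, h1.deriv_eq]
  simpa using h3.deriv

/-! ### Signal-to-noise limit for a family of squeezed vacua -/

/-- The second moment of the readout in the normalised squeezed vacuum with amplitude `z`. -/
def readoutMoment (z : ℂ) : ℝ :=
  (1 - ‖z‖ ^ 2) * (‖1 + z ^ 2‖ ^ 2 * (‖z‖ ^ 2 * (1 + ‖z‖ ^ 2) / (1 - ‖z‖ ^ 2) ^ 3) +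
        2 * (conj (z ^ 2) * (1 + z ^ 2)).re * (‖z‖ ^ 2 / (1 - ‖z‖ ^ 2) ^ 2) +
          ‖z ^ 2‖ ^ 2 * (1 - ‖z‖ ^ 2)⁻¹)

theorem applyOp_readoutO {z : ℂ} (hz : ‖z‖ < 1) (c : ℂ) :
    applyOp (closedOperator readoutO) (c • pairState z) = c • readoutPairState z :=
  applyOp_eq (Submodule.smul_mem _ c (mem_graph_readoutO hz))

theorem norm_applyOp_readoutO_sq {z c : ℂ} (hz : ‖z‖ < 1) (hc : ‖c‖ ^ 2 = 1 - ‖z‖ ^ 2) :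
    ‖applyOp (closedOperator readoutO) (c • pairState z)‖ ^ 2 = readoutMoment z := by
  rw [applyOp_readoutO hz, norm_smul, mul_pow, hc, norm_readoutPairState_sq hz, readoutMoment]

theorem expectation_readoutO {z c : ℂ} (hz : ‖z‖ < 1) (hc : ‖c‖ ^ 2 = 1 - ‖z‖ ^ 2) :
    expectation (closedOperator readoutO) (c • pairState z) =
      2 * z.re * ‖z‖ ^ 2 / (1 - ‖z‖ ^ 2) := by
  have hne : 1 - ‖z‖ ^ 2 ≠ 0 := by nlinarith [norm_nonneg z]
  rw [expectation, applyOp_readoutO hz, inner_smul_left, inner_smul_right, ← mul_assoc,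
    Complex.conj_mul', ← Complex.ofReal_pow, Complex.re_ofReal_mul, hc,
    inner_pairState_readout hz]
  field_simp

theorem continuousAt_readoutMoment {z : ℂ} (hz : ‖z‖ < 1) : ContinuousAt readoutMoment z := by
  have hne : 1 - ‖z‖ ^ 2 ≠ 0 := by nlinarith [norm_nonneg z]
  have hne2 : (1 - ‖z‖ ^ 2) ^ 2 ≠ 0 := pow_ne_zero _ hne
  have hne3 : (1 - ‖z‖ ^ 2) ^ 3 ≠ 0 := pow_ne_zero _ hne
  have hre : Continuous fun z : ℂ => (conj (z ^ 2) * (1 + z ^ 2)).re := by fun_prop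
  unfold readoutMoment
  fun_prop (disch := assumption)

/-- Here z² = -τ², and with x = τ² the three contributions are x(1 + x), -2x² and x². -/
theorem readoutMoment_neg_I_mul {τ : ℝ} (h : τ ^ 2 < 1) :
    readoutMoment (-Complex.I * τ) = τ ^ 2 := by
  have h1 : ‖-Complex.I * (τ : ℂ)‖ ^ 2 = τ ^ 2 := by simp
  have h2 : (-Complex.I * (τ : ℂ)) ^ 2 = ((-τ ^ 2 : ℝ) : ℂ) := by
    rw [mul_pow, neg_sq, Complex.I_sq]
    push_cast
    ring
  have h3 : (1 : ℂ) + ((-τ ^ 2 : ℝ) : ℂ) = ((1 - τ ^ 2 : ℝ) : ℂ) := by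
    push_cast
    ring
  have hne : 1 - τ ^ 2 ≠ 0 := by linarith
  rw [readoutMoment, h2, h3, h1, Complex.conj_ofReal, ← Complex.ofReal_mul, Complex.ofReal_re,
    Complex.norm_real, Complex.norm_real, Real.norm_eq_abs, Real.norm_eq_abs, sq_abs, sq_abs]
  field_simp
  ring

theorem tendsto_signalToNoise {χ : ℝ → FockSpace} {c z : ℝ → ℂ} {h : ℝ → ℝ} {τ : ℝ}
    (hχ : ∀ᶠ θ in 𝓝 0, χ θ = c θ • pairState (z θ)) (hz : ∀ᶠ θ in 𝓝 0, ‖z θ‖ < 1)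
    (hc : ∀ᶠ θ in 𝓝 0, ‖c θ‖ ^ 2 = 1 - ‖z θ‖ ^ 2)
    (hE : ∀ᶠ θ in 𝓝 0, 2 * (z θ).re * ‖z θ‖ ^ 2 / (1 - ‖z θ‖ ^ 2) = θ * h θ)
    (hh : ContDiffAt ℝ 1 h 0) (hzc : ContinuousAt z 0) (hz0 : z 0 = -Complex.I * τ)
    (hτ : τ ≠ 0) :
    Tendsto (signalToNoise (closedOperator readoutO) χ) (𝓝 0) (𝓝 (h 0 ^ 2 / τ ^ 2)) := by
  have hev : (fun θ => expectation (closedOperator readoutO) (χ θ)) =ᶠ[𝓝 0] fun θ => θ * h θ := by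
    filter_upwards [hχ, hz, hc, hE] with θ h1 h2 h3 h4
    rw [h1, expectation_readoutO h2 h3, h4]
  have hz1 : ‖z 0‖ < 1 := hz.self_of_nhds
  have hτ1 : τ ^ 2 < 1 := by
    rw [hz0] at hz1
    have : |τ| < 1 := by simpa using hz1
    exact (sq_lt_one_iff_abs_lt_one τ).2 this
  have hvar : Tendsto (fun θ => variance (closedOperator readoutO) (χ θ)) (𝓝 0) (𝓝 (τ ^ 2)) := by
    have h5 : Tendsto (fun θ => readoutMoment (z θ) - (θ * h θ) ^ 2) (𝓝 0)
        (𝓝 (readoutMoment (z 0) - (0 * h 0) ^ 2)) :=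
      ((continuousAt_readoutMoment hz1).comp hzc).sub
        ((continuousAt_id.mul hh.continuousAt).pow 2)
    rw [hz0, readoutMoment_neg_I_mul hτ1] at h5
    simp only [zero_mul, ne_eq, OfNat.ofNat_ne_zero, not_false_eq_true, zero_pow, sub_zero] at h5
    refine h5.congr' ?_
    filter_upwards [hev, hχ, hz, hc] with θ h1 h2 h3 h4
    rw [variance, h1, h2, norm_applyOp_readoutO_sq h3 h4]
  exact ((tendsto_deriv_of_eventuallyEq_mul hev hh).pow 2).div hvar (pow_ne_zero 2 hτ)

/-! ### The Hamiltonian model -/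

/-- The effective gain `√((2g)² - θ²)`. -/
def gain (g θ : ℝ) : ℝ := √((2 * g) ^ 2 - θ ^ 2)

section

variable {g : ℝ}

theorem gain_zero (hg : 0 < g) : gain g 0 = 2 * g := by
  rw [gain, zero_pow two_ne_zero, sub_zero, Real.sqrt_sq (by positivity)]

theorem contDiffAt_gain (hg : 0 < g) {n : WithTop ℕ∞} : ContDiffAt ℝ n (gain g) 0 := by
  have h : (2 * g) ^ 2 - (0 : ℝ) ^ 2 ≠ 0 := by
    have : 0 < (2 * g) ^ 2 := by positivity
    simpa using this.ne'
  unfold gain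
  fun_prop (disch := assumption)

theorem eventually_sq_lt (hg : 0 < g) : ∀ᶠ θ : ℝ in 𝓝 0, θ ^ 2 < (2 * g) ^ 2 := by
  have : ContinuousAt (fun θ : ℝ => θ ^ 2) 0 := by fun_prop
  exact this.eventually_lt_const (by simp; positivity)

theorem gain_pos {θ : ℝ} (h : θ ^ 2 < (2 * g) ^ 2) : 0 < gain g θ :=
  Real.sqrt_pos.2 (sub_pos.2 h)

theorem gain_sq {θ : ℝ} (h : θ ^ 2 < (2 * g) ^ 2) : gain g θ ^ 2 = (2 * g) ^ 2 - θ ^ 2 :=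
  Real.sq_sqrt (sub_nonneg.2 h.le)

theorem norm_generator_sq (g : ℝ) : ‖-Complex.I * ((2 * g : ℝ) : ℂ)‖ ^ 2 = (2 * g) ^ 2 := by
  rw [norm_mul, norm_neg, Complex.norm_I, one_mul, Complex.norm_real, Real.norm_eq_abs, sq_abs]

theorem gain_sq_add_sq {θ : ℝ} (h : θ ^ 2 < (2 * g) ^ 2) :
    gain g θ ^ 2 + θ ^ 2 = ‖-Complex.I * ((2 * g : ℝ) : ℂ)‖ ^ 2 := by
  rw [gain_sq h, norm_generator_sq]
  ring

/-- The denominator of the squeezing amplitude of the Hamiltonian model. -/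
def probeDen (g θ : ℝ) : ℂ := amplitudeDen θ (gain g θ) 1

/-- The numerator of the squeezing amplitude of the Hamiltonian model. -/
def probeNum (g θ : ℝ) : ℂ := amplitudeNum (-Complex.I * (2 * g : ℝ)) (gain g θ) 1

theorem hamiltonianState_eq {θ : ℝ} (h : θ ^ 2 < (2 * g) ^ 2) :
    hamiltonianState g θ = (Complex.exp (Complex.I * θ) / probeDen g θ) •
      pairState (probeNum g θ / probeDen g θ) := by
  rw [hamiltonianState, hamiltonian_eq_quadGen,
    expApply_quadGen (gain_pos h) (gain_sq_add_sq h), probeDen, probeNum]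

theorem norm_probe_lt_one {θ : ℝ} (h : θ ^ 2 < (2 * g) ^ 2) :
    ‖probeNum g θ / probeDen g θ‖ < 1 :=
  norm_amplitude_lt_one (gain_pos h) (gain_sq_add_sq h) 1

theorem probeDen_ne_zero {θ : ℝ} (h : θ ^ 2 < (2 * g) ^ 2) : probeDen g θ ≠ 0 :=
  amplitudeDen_ne_zero (gain_pos h) (gain_sq_add_sq h) 1

theorem norm_exp_I_mul (θ : ℝ) : ‖Complex.exp (Complex.I * θ)‖ = 1 := by
  rw [mul_comm, Complex.norm_exp_ofReal_mul_I]

theorem probeDen_eq (g θ : ℝ) : probeDen g θ = (Real.cosh (gain g θ) : ℝ) +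
    (θ * (Real.sinh (gain g θ) / gain g θ) : ℝ) * Complex.I := by
  rw [probeDen, amplitudeDen, mul_one]
  push_cast
  ring

theorem probeNum_eq (g θ : ℝ) : probeNum g θ =
    (-(2 * g * (Real.sinh (gain g θ) / gain g θ)) : ℝ) * Complex.I := by
  rw [probeNum, amplitudeNum, mul_one]
  push_cast
  ring

theorem norm_probe_sq {θ : ℝ} (h : θ ^ 2 < (2 * g) ^ 2) :
    ‖probeNum g θ / probeDen g θ‖ ^ 2 = 1 - 1 / ‖probeDen g θ‖ ^ 2 :=
  norm_amplitude_sq (gain_pos h) (gain_sq_add_sq h) 1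

theorem norm_probeDen_sq {θ : ℝ} (h : θ ^ 2 < (2 * g) ^ 2) :
    ‖probeDen g θ‖ ^ 2 = 1 + (2 * g) ^ 2 * (Real.sinh (gain g θ) / gain g θ) ^ 2 := by
  rw [probeDen, norm_amplitudeDen_sq_eq (gain_pos h) (gain_sq_add_sq h), norm_amplitudeNum_sq,
    norm_generator_sq, mul_one]

/-- The quotient of the readout expectation in the Hamiltonian model by `θ`. -/
def probeSlope (g θ : ℝ) : ℝ :=
  -2 * (2 * g) ^ 3 * (Real.sinh (gain g θ) / gain g θ) ^ 4 /
    (1 + (2 * g) ^ 2 * (Real.sinh (gain g θ) / gain g θ) ^ 2)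

theorem probe_expectation {θ : ℝ} (h : θ ^ 2 < (2 * g) ^ 2) :
    2 * (probeNum g θ / probeDen g θ).re * ‖probeNum g θ / probeDen g θ‖ ^ 2 /
      (1 - ‖probeNum g θ / probeDen g θ‖ ^ 2) = θ * probeSlope g θ := by
  have hW : ‖probeDen g θ‖ ^ 2 ≠ 0 :=
    pow_ne_zero 2 (norm_ne_zero_iff.2 (probeDen_ne_zero h))
  -- The numerator is purely imaginary and the imaginary part of the denominator is proportional to
  -- θ, which produces the factor θ.
  have hre : (probeNum g θ / probeDen g θ).re =
      -(2 * g * θ * (Real.sinh (gain g θ) / gain g θ) ^ 2) / ‖probeDen g θ‖ ^ 2 := by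
    rw [Complex.div_re, Complex.normSq_eq_norm_sq, ← add_div]
    congr 1
    rw [probeNum_eq, probeDen_eq]
    simp [-Complex.ofReal_mul, -Complex.ofReal_div, -Complex.ofReal_neg, -Complex.ofReal_cosh]
    ring
  rw [norm_probe_sq h, hre, probeSlope, ← norm_probeDen_sq h]
  have h1 := norm_probeDen_sq h
  generalize ‖probeDen g θ‖ ^ 2 = w at hW h1
  generalize Real.sinh (gain g θ) / gain g θ = q at h1
  have h2 : (1 : ℝ) - (1 - 1 / w) ≠ 0 := by
    simpa using hW
  field_simp
  subst h1
  ring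

theorem contDiffAt_sinh_gain_div (hg : 0 < g) {n : WithTop ℕ∞} :
    ContDiffAt ℝ n (fun θ => Real.sinh (gain g θ) / gain g θ) 0 :=
  (contDiffAt_gain hg).sinh.div (contDiffAt_gain hg) (by rw [gain_zero hg]; positivity)

theorem contDiffAt_probeSlope (hg : 0 < g) : ContDiffAt ℝ 1 (probeSlope g) 0 := by
  have h := contDiffAt_sinh_gain_div hg (n := 1)
  refine (contDiffAt_const.mul (h.pow 4)).div
    (contDiffAt_const.add (contDiffAt_const.mul (h.pow 2))) ?_
  positivity

theorem probeSlope_zero (hg : 0 < g) :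
    probeSlope g 0 = -Real.sinh (2 * g) ^ 4 / (g * Real.cosh (2 * g) ^ 2) := by
  rw [probeSlope, gain_zero hg, Real.cosh_sq]
  field_simp
  ring

theorem tendsto_signalToNoise_hamiltonianState (hg : 0 < g) :
    Tendsto (signalToNoise (closedOperator readoutO) (hamiltonianState g)) (𝓝 0)
      (𝓝 (Real.tanh (2 * g) ^ 2 * (Real.sinh (2 * g) ^ 4 / g ^ 2))) := by
  have hev := eventually_sq_lt hg
  have h0 : (0 : ℝ) ^ 2 < (2 * g) ^ 2 := hev.self_of_nhds
  have hs : 0 < Real.sinh (2 * g) := Real.sinh_pos_iff.2 (by positivity)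
  have hcosh : 0 < Real.cosh (2 * g) := Real.cosh_pos _
  have ht : Real.tanh (2 * g) ≠ 0 := by
    rw [Real.tanh_eq_sinh_div_cosh]
    positivity
  have h := tendsto_signalToNoise (χ := hamiltonianState g) (h := probeSlope g)
    (τ := Real.tanh (2 * g)) (hev.mono fun θ h => hamiltonianState_eq h)
    (hev.mono fun θ h => norm_probe_lt_one h)
    (hev.mono fun θ h => by
      rw [norm_div, norm_exp_I_mul, norm_probe_sq h]
      simp)
    (hev.mono fun θ h => probe_expectation h) (contDiffAt_probeSlope hg)
    (by
      have hq := (contDiffAt_sinh_gain_div hg (n := 0)).continuousAt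
      have hk := (contDiffAt_gain hg (n := 0)).cosh.continuousAt
      refine ContinuousAt.div ?_ ?_ (probeDen_ne_zero h0)
      · simp only [funext (probeNum_eq g)]
        fun_prop
      · simp only [funext (probeDen_eq g)]
        fun_prop)
    (by
      rw [probeNum_eq, probeDen_eq, gain_zero hg, Real.tanh_eq_sinh_div_cosh]
      have h2 : (2 * g * (Real.sinh (2 * g) / (2 * g)) : ℝ) = Real.sinh (2 * g) := by field_simp
      rw [h2]
      push_cast
      simp
      ring)
    ht
  convert h using 2
  rw [probeSlope_zero hg, Real.tanh_eq_sinh_div_cosh]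
  field_simp

/-! ### The approximate family -/

/-- The squeezing parameter of the approximate probe state. -/
def approxParam (g θ : ℝ) : ℂ :=
  (gain g θ : ℂ) * Complex.exp (Complex.I * ((Real.pi + Real.arccos (θ / (2 * g)) : ℝ) : ℂ))

/-- The squeezing amplitude of the approximate probe state. -/
def approxAmplitude (g θ : ℝ) : ℂ :=
  Complex.exp (Complex.I * ((Real.pi + Real.arccos (θ / (2 * g)) : ℝ) : ℂ)) *
    (Real.tanh (gain g θ) : ℝ)

theorem norm_approxAmplitude_sq (g θ : ℝ) :
    ‖approxAmplitude g θ‖ ^ 2 = Real.tanh (gain g θ) ^ 2 := by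
  rw [approxAmplitude, norm_mul, norm_exp_I_mul, one_mul, Complex.norm_real, Real.norm_eq_abs,
    sq_abs]

theorem one_sub_tanh_sq (x : ℝ) : 1 - Real.tanh x ^ 2 = 1 / Real.cosh x ^ 2 := by
  have := Real.cosh_pos x
  rw [Real.tanh_eq_sinh_div_cosh]
  field_simp
  linarith [Real.cosh_sq x]

theorem approxState_eq {θ : ℝ} (h : θ ^ 2 < (2 * g) ^ 2) :
    approxState g θ = ((1 / Real.cosh (gain g θ) : ℝ) : ℂ) • pairState (approxAmplitude g θ) := by
  have hk := gain_pos h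
  have hk' : (gain g θ : ℂ) ≠ 0 := by exact_mod_cast hk.ne'
  have hc : (Real.cosh (gain g θ) : ℂ) ≠ 0 := by exact_mod_cast (Real.cosh_pos _).ne'
  have hn : gain g θ ^ 2 + 0 ^ 2 = ‖approxParam g θ‖ ^ 2 := by
    rw [approxParam, norm_mul, norm_exp_I_mul, Complex.norm_real, Real.norm_eq_abs, mul_one,
      sq_abs]
    ring
  have e : approxState g θ = expApply (closedOperator (squeezer (approxParam g θ))) vacuum := rfl
  have hden : amplitudeDen 0 (gain g θ) 1 = Real.cosh (gain g θ) := by simp [amplitudeDen]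
  rw [e, squeezer_eq_quadGen, expApply_quadGen hk hn, hden]
  congr 1
  · simp
  · congr 1
    rw [amplitudeNum, approxParam, approxAmplitude, Real.tanh_eq_sinh_div_cosh, mul_one]
    push_cast at hc ⊢
    field_simp

/-- The quotient of the readout expectation in the approximate family by `θ`. -/
def approxSlope (g θ : ℝ) : ℝ := -Real.sinh (gain g θ) ^ 3 / (g * Real.cosh (gain g θ))

theorem approx_expectation {θ : ℝ} (hg : 0 < g) (h : θ ^ 2 < (2 * g) ^ 2) :
    2 * (approxAmplitude g θ).re * ‖approxAmplitude g θ‖ ^ 2 /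
      (1 - ‖approxAmplitude g θ‖ ^ 2) = θ * approxSlope g θ := by
  have hab := abs_lt_of_sq_lt_sq' h (by positivity)
  -- The factor θ comes from the phase: cos(π + arccos(θ/λ)) = -θ/λ.
  have hre : (approxAmplitude g θ).re = -(θ / (2 * g)) * Real.tanh (gain g θ) := by
    rw [approxAmplitude, Complex.re_mul_ofReal, mul_comm Complex.I, Complex.exp_ofReal_mul_I_re,
      add_comm, Real.cos_add_pi, Real.cos_arccos]
    · rw [le_div_iff₀ (by positivity)]
      linarith
    · rw [div_le_one (by positivity)]
      linarith
  have := Real.cosh_pos (gain g θ)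
  rw [norm_approxAmplitude_sq, one_sub_tanh_sq, hre, approxSlope, Real.tanh_eq_sinh_div_cosh]
  field_simp

theorem tendsto_signalToNoise_approxState (hg : 0 < g) :
    Tendsto (signalToNoise (closedOperator readoutO) (approxState g)) (𝓝 0)
      (𝓝 (Real.sinh (2 * g) ^ 4 / g ^ 2)) := by
  have hev := eventually_sq_lt hg
  have hs : 0 < Real.sinh (2 * g) := Real.sinh_pos_iff.2 (by positivity)
  have hcosh : 0 < Real.cosh (2 * g) := Real.cosh_pos _
  have ht : Real.tanh (2 * g) ≠ 0 := by
    rw [Real.tanh_eq_sinh_div_cosh]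
    positivity
  have hgain := contDiffAt_gain hg (n := 1)
  have h := tendsto_signalToNoise (χ := approxState g) (h := approxSlope g)
    (z := approxAmplitude g)
    (τ := Real.tanh (2 * g)) (hev.mono fun θ h => approxState_eq h)
    (Eventually.of_forall fun θ => by
      have h1 := norm_approxAmplitude_sq g θ
      have h2 := one_sub_tanh_sq (gain g θ)
      have h3 : 0 < 1 / Real.cosh (gain g θ) ^ 2 := by
        have := Real.cosh_pos (gain g θ)
        positivity
      nlinarith [norm_nonneg (approxAmplitude g θ)])
    (Eventually.of_forall fun θ => by
      rw [norm_approxAmplitude_sq, one_sub_tanh_sq, Complex.norm_real, Real.norm_eq_abs, sq_abs,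
        div_pow, one_pow])
    (hev.mono fun θ h => approx_expectation hg h)
    (by
      refine (hgain.sinh.pow 3).neg.div (contDiffAt_const.mul hgain.cosh) ?_
      have := Real.cosh_pos (gain g 0)
      positivity)
    (by
      have hk : ContinuousAt (fun θ => Real.tanh (gain g θ)) 0 := by
        simp only [Real.tanh_eq_sinh_div_cosh]
        exact hgain.sinh.continuousAt.div hgain.cosh.continuousAt (Real.cosh_pos _).ne'
      have ha : Continuous fun θ => Real.arccos (θ / (2 * g)) :=
        Real.continuous_arccos.comp (continuous_id.div_const _)
      unfold approxAmplitude
      fun_prop)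
    (by
      have hI : Complex.exp (Complex.I * ((Real.pi + Real.pi / 2 : ℝ) : ℂ)) = -Complex.I := by
        push_cast
        rw [mul_comm, add_mul, Complex.exp_add, Complex.exp_pi_mul_I,
          Complex.exp_pi_div_two_mul_I]
        ring
      rw [approxAmplitude, gain_zero hg, zero_div, Real.arccos_zero, hI])
    ht
  convert h using 2
  rw [approxSlope, gain_zero hg, Real.tanh_eq_sinh_div_cosh]
  field_simp

/-! ### Quantum Fisher information of the Hamiltonian model -/

/-- The inverse fidelity `1 / |⟨ψ(g,0)|ψ(g,θ)⟩|²` of the Hamiltonian model, at `p = θ²`. -/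
def inverseFidelity (g p : ℝ) : ℝ :=
  (Real.cosh (2 * g) * Real.cosh √((2 * g) ^ 2 - p) -
      2 * g * Real.sinh (2 * g) * (Real.sinh √((2 * g) ^ 2 - p) / √((2 * g) ^ 2 - p))) ^ 2 +
    p * (Real.cosh (2 * g) * (Real.sinh √((2 * g) ^ 2 - p) / √((2 * g) ^ 2 - p))) ^ 2

theorem fidelity_eq (hg : 0 < g) {θ : ℝ} (h : θ ^ 2 < (2 * g) ^ 2) :
    ‖(inner ℂ (hamiltonianState g 0) (hamiltonianState g θ) : ℂ)‖ ^ 2 =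
      (inverseFidelity g (θ ^ 2))⁻¹ := by
  have h0 : (0 : ℝ) ^ 2 < (2 * g) ^ 2 := (eventually_sq_lt hg).self_of_nhds
  have hW := probeDen_ne_zero h
  have hW0 : conj (probeDen g 0) ≠ 0 := (map_ne_zero _).2 (probeDen_ne_zero h0)
  -- The normalising denominators cancel against those of the overlap (1 - z̄₀z)⁻¹, leaving a unit
  -- phase over an SU(1,1) form.
  have e1 : inner ℂ (hamiltonianState g 0) (hamiltonianState g θ) =
      Complex.exp (Complex.I * θ) /
        (conj (probeDen g 0) * probeDen g θ - conj (probeNum g 0) * probeNum g θ) := by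
    rw [hamiltonianState_eq h0, hamiltonianState_eq h, inner_smul_left, inner_smul_right,
      inner_pairState (norm_probe_lt_one h0) (norm_probe_lt_one h), map_div₀, map_div₀]
    have e : 1 - conj (probeNum g 0) / conj (probeDen g 0) * (probeNum g θ / probeDen g θ) =
        (conj (probeDen g 0) * probeDen g θ - conj (probeNum g 0) * probeNum g θ) /
          (conj (probeDen g 0) * probeDen g θ) := by
      field_simp
    rw [e, inv_div]
    field_simp
    simp
  have e2 : conj (probeDen g 0) * probeDen g θ - conj (probeNum g 0) * probeNum g θ =
      ((Real.cosh (2 * g) * Real.cosh (gain g θ) -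
        2 * g * Real.sinh (2 * g) * (Real.sinh (gain g θ) / gain g θ) : ℝ) : ℂ) +
      ((θ * (Real.cosh (2 * g) * (Real.sinh (gain g θ) / gain g θ)) : ℝ) : ℂ) * Complex.I := by
    have hs : 2 * g * (Real.sinh (2 * g) / (2 * g)) = Real.sinh (2 * g) := by field_simp
    rw [probeDen_eq, probeDen_eq, probeNum_eq, probeNum_eq, gain_zero hg, hs]
    generalize Real.sinh (gain g θ) / gain g θ = q
    generalize Real.sinh (2 * g) = s
    generalize Real.cosh (2 * g) = c
    generalize Real.cosh (gain g θ) = d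
    simp only [zero_mul, Complex.ofReal_zero, add_zero, map_mul, Complex.conj_ofReal,
      Complex.conj_I]
    push_cast
    linear_combination (s * (2 * g * q) : ℂ) * Complex.I_sq
  rw [e1, e2, norm_div, norm_exp_I_mul, one_div, inv_pow, ← Complex.normSq_eq_norm_sq,
    Complex.normSq_add_mul_I, inverseFidelity, mul_pow θ, gain]

theorem hasDerivAt_inverseFidelity (hg : 0 < g) :
    HasDerivAt (inverseFidelity g) (Real.sinh (2 * g) ^ 4 / (2 * g) ^ 2) 0 := by
  have hl : 0 < 2 * g := by positivity
  have hk0 : √((2 * g) ^ 2 - 0) = 2 * g := by rw [sub_zero, Real.sqrt_sq hl.le]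
  have hk : HasDerivAt (fun p : ℝ => √((2 * g) ^ 2 - p)) (-1 / (2 * (2 * g))) 0 := by
    have := ((hasDerivAt_id (0 : ℝ)).const_sub ((2 * g) ^ 2)).sqrt (by simp; positivity)
    simpa only [id, hk0] using this
  have hq := hk.sinh.div hk (by rw [hk0]; exact hl.ne')
  have h := (((hk.cosh.const_mul (Real.cosh (2 * g))).sub
    (hq.const_mul (2 * g * Real.sinh (2 * g)))).pow 2).add
    ((hasDerivAt_id (0 : ℝ)).mul ((hq.const_mul (Real.cosh (2 * g))).pow 2))
  refine h.congr_deriv ?_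
  simp only [Pi.sub_apply, Pi.div_apply, Pi.pow_apply, hk0, id]
  -- The identity is polynomial in c and s: the c²s² terms of the two summands cancel, so c² - s² =
  -- 1 is not needed.
  generalize Real.cosh (2 * g) = c
  generalize Real.sinh (2 * g) = s
  generalize 2 * g = l at hl
  field_simp
  push_cast
  ring

theorem inverseFidelity_zero (hg : 0 < g) : inverseFidelity g 0 = 1 := by
  have hl : 0 < 2 * g := by positivity
  rw [inverseFidelity, sub_zero, Real.sqrt_sq hl.le]
  have hc := Real.cosh_sq (2 * g)
  field_simp
  rw [hc]
  ring

theorem contDiffAt_inverseFidelity (hg : 0 < g) : ContDiffAt ℝ 2 (inverseFidelity g) 0 := by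
  have h : (2 * g) ^ 2 - (0 : ℝ) ≠ 0 := by
    have : 0 < (2 * g) ^ 2 := by positivity
    simpa using this.ne'
  have hk0 : √((2 * g) ^ 2 - 0) ≠ 0 := by
    rw [sub_zero, Real.sqrt_sq (by positivity)]
    positivity
  unfold inverseFidelity
  fun_prop (disch := assumption)

theorem QFI_hamiltonianState (hg : 0 < g) :
    QFI (hamiltonianState g) 0 = Real.sinh (2 * g) ^ 4 / g ^ 2 := by
  have h0 := inverseFidelity_zero hg
  have hne : inverseFidelity g 0 ≠ 0 := by simp [h0]
  have hd : HasDerivAt (inverseFidelity g)⁻¹ _ 0 :=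
    (hasDerivAt_inverseFidelity hg).inv hne
  rw [QFI, iteratedDeriv_two_of_eventuallyEq_sq
    ((eventually_sq_lt hg).mono fun θ h => fidelity_eq hg h)
    ((contDiffAt_inverseFidelity hg).inv hne), hd.deriv, h0]
  field_simp

end

/-! ### The limit of large gain -/

theorem tendsto_tanh_sq_atTop : Tendsto (fun g : ℝ => Real.tanh (2 * g) ^ 2) atTop (𝓝 1) := by
  have h1 : Tendsto (fun g : ℝ => Real.cosh (2 * g) ^ 2) atTop atTop := by
    refine tendsto_atTop_mono' _ ?_ tendsto_id
    filter_upwards [eventually_ge_atTop 0] with g hg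
    have := Real.self_le_sinh_iff.2 (show 0 ≤ 2 * g by positivity)
    rw [Real.cosh_sq, id]
    nlinarith
  have h2 := h1.inv_tendsto_atTop.const_sub 1
  rw [sub_zero] at h2
  refine h2.congr fun g => ?_
  have := one_sub_tanh_sq (2 * g)
  rw [Pi.inv_apply, ← one_div, ← this]
  ring

end SU11

end

theorem mainTheorem5 :
    (∀ g : ℝ, 0 < g →
      Filter.Tendsto
        (fun θ => SU11.signalToNoise (SU11.closedOperator SU11.readoutO) (SU11.approxState g) θ)
        (nhdsWithin 0 {0}ᶜ) (nhds (Real.sinh (2 * g) ^ 4 / g ^ 2)) ∧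
      SU11.QFI (SU11.hamiltonianState g) 0 = Real.sinh (2 * g) ^ 4 / g ^ 2) ∧
    ∃ S : ℝ → ℝ,
      (∀ g : ℝ, 0 < g →
        Filter.Tendsto
          (fun θ =>
            SU11.signalToNoise (SU11.closedOperator SU11.readoutO) (SU11.hamiltonianState g) θ)
          (nhdsWithin 0 {0}ᶜ) (nhds (S g))) ∧
      Filter.Tendsto (fun g => S g / SU11.QFI (SU11.hamiltonianState g) 0)
        Filter.atTop (nhds 1) := by
  refine ⟨fun g hg => ⟨(SU11.tendsto_signalToNoise_approxState hg).mono_left nhdsWithin_le_nhds,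
    SU11.QFI_hamiltonianState hg⟩,
    fun g => Real.tanh (2 * g) ^ 2 * (Real.sinh (2 * g) ^ 4 / g ^ 2),
    fun g hg => (SU11.tendsto_signalToNoise_hamiltonianState hg).mono_left nhdsWithin_le_nhds, ?_⟩
  refine SU11.tendsto_tanh_sq_atTop.congr' ?_
  filter_upwards [Filter.eventually_gt_atTop 0] with g hg
  have hs : 0 < Real.sinh (2 * g) := Real.sinh_pos_iff.2 (by positivity)
  rw [SU11.QFI_hamiltonianState hg, mul_div_assoc, div_self (by positivity), mul_one]
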